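/- Let $H,K\in(0,1)$ and let $B=\{B_t;\ t\in\mathbb R\}$ be a two-parameter fractional Brownian motion (bifractional Brownian motion), i.e. a continuous centered Gaussian process with covariance $$\mathrm{Cov}(B_s,B_t)=2^{-K}\left((|s|^{2H}+|t|^{2H})^K-|s-t|^{2HK}\right),\qquad s,t\in\mathbb R.$$ Let $0<T_1<T_2$ and, for $t\in[0,1]$, put $Y_t=B_{(T_2-T_1)t+T_1}$. For $n\ge 1$ let $$V_n(Y)=\sum_{k=1}^{n-1}\left(Y_{(k+1)/n}+Y_{(k-1)/n}-2Y_{k/n}\right)^2 .$$ For $0<\gamma<2$ and an integer $l\ge 2$ let $$\rho_\gamma(l)=\int_l^{l+1}du\int_{u-1}^{u}dv\int_0^1dx\int_{x-1}^x\frac{dy}{(v-y)^{2+\gamma}},\qquad \|\rho_\gamma\|^2=\sum_{l=2}^{\infty}\rho_\gamma(l)^2,$$ and for $0<h<1$ let $$\sigma^2_{\mathrm{FBM},h}=2(4-2^{2h})^2+(2^{2h+2}-7-3^{2h})^2+(2h)^2(2h-1)^2(2h-2)^2(2h-3)^2\,\|\rho_{2-2h}\|^2 .$$ Then the series defining $\|\rho_{2-2HK}\|^2$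 converges and, as $n\to\infty$, $$\sqrt n\left(n^{2HK-1}V_n(Y)-\frac{4-2^{2HK}}{2^{K-1}}(T_2-T_1)^{2HK}\right)\ \longrightarrow\ \mathcal N\left(0,\ \frac{(T_2-T_1)^{4HK}}{2^{2(K-1)}}\,\sigma^2_{\mathrm{FBM},HK}\right)$$ in law. -/

import Mathlib

open MeasureTheory ProbabilityTheory Filter

namespace TwoParamFBM

/-- The covariance function `2^{-K} ((|s|^{2H} + |t|^{2H})^K - |s - t|^{2HK})` of two-parameter
fractional Brownian motion (also called bifractional Brownian motion). -/
noncomputable def covFun (H K s t : ℝ) : ℝ :=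
  (1 / 2 ^ K) * ((|s| ^ (2 * H) + |t| ^ (2 * H)) ^ K - |s - t| ^ (2 * H * K))

/-- `B` is a two-parameter fractional Brownian motion with parameters `H`, `K` under `P`: a centered
Gaussian process indexed by `ℝ`, with almost surely continuous paths and covariance `covFun H K`. -/
structure IsTwoParamFBM {Ω : Type*} [MeasurableSpace Ω] (H K : ℝ) (B : ℝ → Ω → ℝ)
    (P : Measure Ω) : Prop where
  isGaussianProcess : IsGaussianProcess B P
  continuous_paths : ∀ᵐ ω ∂P, Continuous fun t => B t ω
  centered : ∀ t, ∫ ω, B t ω ∂P = 0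
  cov_eq : ∀ s t, cov[B s, B t; P] = covFun H K s t

/-- The process `Y_t = B_{(T₂ - T₁) t + T₁}`, i.e. `B` observed on `[T₁, T₂]` and re-indexed
by `[0, 1]`. -/
def rescale {Ω : Type*} (B : ℝ → Ω → ℝ) (T₁ T₂ : ℝ) : ℝ → Ω → ℝ :=
  fun t ω => B ((T₂ - T₁) * t + T₁) ω

/-- Second-order quadratic variation
`V_n(X) = ∑_{k=1}^{n-1} (X_{(k+1)/n} + X_{(k-1)/n} - 2 X_{k/n})²`;
it uses only the values of `X` on `[0, 1]`. -/
noncomputable def quadVar {Ω : Type*} (X : ℝ → Ω → ℝ) (n : ℕ) (ω : Ω) : ℝ :=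
  ∑ k ∈ Finset.Icc 1 (n - 1),
    (X (((k : ℝ) + 1) / n) ω + X (((k : ℝ) - 1) / n) ω - 2 * X ((k : ℝ) / n) ω) ^ 2

/-- `ρ_γ(j, k) = ∫_j^{j+1} du ∫_{u-1}^u dv ∫_k^{k+1} dx ∫_{x-1}^x dy (v - y)^{-(2+γ)}`,
used for `j - k ≥ 2` and `0 < γ < 2`, where the integrand is positive almost everywhere and
integrable. -/
noncomputable def rho₂ (γ : ℝ) (j k : ℤ) : ℝ :=
  ∫ u in (j : ℝ)..(j + 1), ∫ v in (u - 1)..u,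
    ∫ x in (k : ℝ)..(k + 1), ∫ y in (x - 1)..x, 1 / (v - y) ^ (2 + γ)

/-- `ρ_γ(l)`, the common value of `ρ_γ(j, k)` for `j - k = l`. -/
noncomputable def rho (γ : ℝ) (l : ℕ) : ℝ := rho₂ γ l 0

/-- `‖ρ_γ‖² = ∑_{l ≥ 2} ρ_γ(l)²`. -/
noncomputable def rhoNormSq (γ : ℝ) : ℝ := ∑' l : ℕ, rho γ (l + 2) ^ 2

/-- The constant `σ²_{FBM,H}`. -/
noncomputable def sigmaSqFBM (H : ℝ) : ℝ :=
  2 * (4 - 2 ^ (2 * H)) ^ 2 + (2 ^ (2 * H + 2) - 7 - 3 ^ (2 * H)) ^ 2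
    + (2 * H) ^ 2 * (2 * H - 1) ^ 2 * (2 * H - 2) ^ 2 * (2 * H - 3) ^ 2 * rhoNormSq (2 - 2 * H)

end TwoParamFBM

namespace TwoParamFBM

open scoped Topology

/-! Put p = 2HK. Then √n n^(p-1) V_n is the squared norm of a centered Gaussian vector: the
second-order increments of B along the grid, scaled by n^(p/2-1/4). If λ runs over the eigenvalues
of the covariance matrix A of such a vector, the logarithm of the characteristic function of its
squared norm is -½ Σ log(1 - 2itλ) = it tr A - t² Σ λ² + O(|t|³ Σ |λ|³) for small λ. Since Σ λ² is
the sum of the squared entries of A, a Gaussian limit of variance 2 lim Σ A_jk² follows once the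
absolute row sums, which bound |λ|, tend to 0 (`tendstoInDistribution_sum_sq`).

On s, t ≥ T₁ > 0 the covariance is a smooth function minus 2^(-K) |s - t|^p. The mixed second
difference of the smooth part is O(n^(-4)) and negligible
(`exists_abs_secondDiff_secondDiff_powSum_le`). That of |s - t|^p is a fourth central difference in
the lag j - k, so A is nearly Toeplitz (`cov_increment`,
`tendstoInDistribution_sum_sq_of_toeplitz`). For lags at least 2 the fourth difference is a fourfold
integral (`fourthDiff_eq_rho`), whence summability; lag 0, lag 1 and the lags from 2 on yield the
three terms of σ². -/

/-! ### Squared norms of Gaussian vectors: characteristic functions and a central limit theorem. -/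

lemma integral_cexp_sq_gaussianReal (v : NNReal) (s : ℝ) :
    ∫ x : ℝ, Complex.exp (s * (x ^ 2 : ℝ) * Complex.I) ∂(gaussianReal 0 v) =
      Complex.exp (-(1 / 2) * Complex.log (1 + (-2 * (s * v) * Complex.I))) := by
  by_cases hv : v = 0
  · subst hv
    simp
  have hv' : (0 : ℝ) < v := by positivity
  rw [integral_gaussianReal_eq_integral_smul hv]
  set w : ℂ := 1 + (-2 * (s * v) * Complex.I) with hw
  have hwre : w.re = 1 := by simp [hw]
  have hw0 : w ≠ 0 := fun h => by simp [h] at hwre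
  set b : ℂ := w / (2 * v : ℝ) with hb
  have hbre : 0 < b.re := by
    rw [hb, Complex.div_ofReal_re, hwre]; positivity
  have hfun : ∀ x : ℝ, gaussianPDFReal 0 v x • Complex.exp (s * (x ^ 2 : ℝ) * Complex.I) =
      ((√(2 * Real.pi * v))⁻¹ : ℝ) * Complex.exp (-b * x ^ 2) := by
    intro x
    rw [gaussianPDFReal, Complex.real_smul, Complex.ofReal_mul, mul_assoc, Complex.ofReal_exp,
      ← Complex.exp_add]
    congr 2
    rw [hb, hw]
    have : (v : ℂ) ≠ 0 := by exact_mod_cast hv'.ne'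
    push_cast
    field_simp
    ring
  simp_rw [hfun]
  rw [integral_const_mul, integral_gaussian_complex hbre]
  have hpi : (Real.pi : ℂ) / b = ((2 * Real.pi * v : ℝ) : ℂ) * w⁻¹ := by
    rw [hb]; push_cast
    have : (v : ℂ) ≠ 0 := by exact_mod_cast hv'.ne'
    field_simp
  have hpos : (0 : ℝ) < 2 * Real.pi * v := by positivity
  have hne : (Real.pi : ℂ) / b ≠ 0 := by
    rw [hpi]; exact mul_ne_zero (by exact_mod_cast hpos.ne') (inv_ne_zero hw0)
  -- The principal logarithm is additive here because `w` has real part 1 and so avoids the branch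
  -- cut.
  rw [Complex.cpow_def_of_ne_zero hne, hpi, Complex.log_ofReal_mul hpos (inv_ne_zero hw0),
    Complex.log_inv _ (by
      intro h
      have := (Complex.arg_eq_pi_iff.1 h).1
      linarith), add_mul, Complex.exp_add, ← mul_assoc]
  have h1 : Complex.exp ((Real.log (2 * Real.pi * v) : ℂ) * (1 / 2)) = (√(2 * Real.pi * v) : ℝ) := by
    rw [Real.sqrt_eq_rpow, Real.rpow_def_of_pos hpos]
    push_cast
    rfl
  rw [h1, ← Complex.ofReal_mul, inv_mul_cancel₀ (by positivity)]
  simp only [Complex.ofReal_one, one_mul]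
  congr 1
  ring

/-- With z = -2is, -½ (z - z²/2) = is - s², so only the third-order Taylor remainder of the
logarithm is left. The assumption |s| ≤ 1/4 gives ‖z‖ ≤ 1/2. -/
lemma norm_log_sub_le (s : ℝ) (hs : |s| ≤ 1 / 4) :
    ‖-(1 / 2) * Complex.log (1 + (-2 * s * Complex.I)) - s * Complex.I + s ^ 2‖ ≤ 3 * |s| ^ 3 := by
  set z : ℂ := -2 * s * Complex.I with hz
  have hzn : ‖z‖ = 2 * |s| := by simp [hz]
  have h := Complex.norm_log_sub_logTaylor_le 2 (z := z) (by rw [hzn]; linarith)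
  have hT : Complex.logTaylor (2 + 1) z = z - z ^ 2 / 2 := by
    simp [Complex.logTaylor_succ, Complex.logTaylor_zero]; ring
  have hz2 : z ^ 2 = -4 * s ^ 2 := by
    rw [hz]; ring_nf; rw [Complex.I_sq]; ring
  have e : -(1 / 2) * Complex.log (1 + z) - s * Complex.I + s ^ 2 =
      -(1 / 2) * (Complex.log (1 + z) - Complex.logTaylor (2 + 1) z) := by
    rw [hT, hz2, hz]; ring
  rw [e, norm_mul]
  have hc : ‖(-(1 / 2) : ℂ)‖ = 1 / 2 := by norm_num
  rw [hc]
  have hb : (1 - ‖z‖)⁻¹ ≤ 2 := by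
    rw [hzn]
    exact inv_le_of_inv_le₀ (by norm_num) (by linarith)
  have h0 : (0 : ℝ) ≤ |s| := abs_nonneg s
  calc (1 / 2 : ℝ) * ‖Complex.log (1 + z) - Complex.logTaylor (2 + 1) z‖
      ≤ 1 / 2 * (‖z‖ ^ (2 + 1) * 2 / ((2 : ℕ) + 1)) := by
        refine mul_le_mul_of_nonneg_left (h.trans ?_) (by norm_num)
        gcongr
    _ ≤ 3 * |s| ^ 3 := by
        rw [hzn]; push_cast
        nlinarith [pow_nonneg h0 3]

section Spectral

variable {ι : Type*} [Fintype ι] [DecidableEq ι] {A : Matrix ι ι ℝ} (hA : A.IsHermitian)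

/-- Each λ_i² is the squared norm of A applied to the i-th eigenvector; Parseval in the eigenbasis
is then applied to every row of A. -/
lemma sum_eigenvalues_sq : ∑ i, hA.eigenvalues i ^ 2 = ∑ j, ∑ k, A j k ^ 2 := by
  have h1 : ∀ i, hA.eigenvalues i ^ 2 =
      ∑ k, (A.mulVec (hA.eigenvectorBasis i).ofLp k) ^ 2 := by
    intro i
    rw [hA.mulVec_eigenvectorBasis]
    simp only [Pi.smul_apply, smul_eq_mul, mul_pow, ← Finset.mul_sum]
    have := EuclideanSpace.norm_sq_eq (hA.eigenvectorBasis i)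
    rw [hA.eigenvectorBasis.orthonormal.1 i] at this
    simp only [Real.norm_eq_abs, sq_abs] at this
    rw [← this]; ring
  simp_rw [h1]
  rw [Finset.sum_comm]
  refine Finset.sum_congr rfl fun k _ => ?_
  have := hA.eigenvectorBasis.sum_sq_inner_right (WithLp.toLp 2 (A k))
  rw [EuclideanSpace.norm_sq_eq] at this
  simp only [Real.norm_eq_abs, sq_abs] at this
  rw [← this]
  refine Finset.sum_congr rfl fun i _ => ?_
  congr 1

/-- Gershgorin's circle theorem. -/
lemma abs_eigenvalues_le {r : ℝ} (hr : ∀ i, ∑ j, |A i j| ≤ r) (i : ι) :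
    |hA.eigenvalues i| ≤ r := by
  have hne : (hA.eigenvectorBasis i).ofLp ≠ 0 := by
    intro h
    have := hA.eigenvectorBasis.orthonormal.1 i
    rw [show hA.eigenvectorBasis i = 0 from by ext k; simp [h]] at this
    simp at this
  have : Module.End.HasEigenvalue (Matrix.toLin' A) (hA.eigenvalues i) :=
    Module.End.hasEigenvalue_of_hasEigenvector (x := (hA.eigenvectorBasis i).ofLp)
      ⟨Module.End.mem_eigenspace_iff.2 (by
        rw [Matrix.toLin'_apply]; exact hA.mulVec_eigenvectorBasis i), hne⟩
  obtain ⟨k, hk⟩ := eigenvalue_mem_ball this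
  rw [Metric.mem_closedBall, Real.dist_eq] at hk
  have h2 : |hA.eigenvalues i| ≤ |hA.eigenvalues i - A k k| + |A k k| := by
    simpa using abs_add_le (hA.eigenvalues i - A k k) (A k k)
  have h3 := hr k
  rw [← Finset.add_sum_erase _ _ (Finset.mem_univ k)] at h3
  simp only [Real.norm_eq_abs] at hk
  linarith

end Spectral

variable {Ω : Type*} [MeasurableSpace Ω] {P : Measure Ω}

/-- Rotating X into an eigenbasis of its covariance preserves the sum of squares and makes the
coordinates uncorrelated, hence independent by joint Gaussianity, with the eigenvalues as variances.
-/
lemma charFun_sum_sq {ι : Type*} [Fintype ι] [DecidableEq ι] {X : ι → Ω → ℝ}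
    (hX : HasGaussianLaw (fun ω => (X · ω)) P) (hc : ∀ i, ∫ ω, X i ω ∂P = 0)
    {A : Matrix ι ι ℝ} (hcov : ∀ i j, cov[X i, X j; P] = A i j) (hA : A.IsHermitian) (t : ℝ) :
    charFun (P.map fun ω => ∑ i, X i ω ^ 2) t =
      Complex.exp (∑ i, -(1 / 2) *
        Complex.log (1 + (-2 * ((t * hA.eigenvalues i : ℝ) : ℂ) * Complex.I))) := by
  have := hX.isProbabilityMeasure
  set b := hA.eigenvectorBasis with hb
  set Z : ι → Ω → ℝ := fun i ω => ∑ k, b i k * X k ω with hZ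
  have hL2 : ∀ i, MemLp (X i) 2 P := fun i => (hX.eval i).memLp_two
  have hZg : HasGaussianLaw (fun ω => (Z · ω)) P := by
    let L : (ι → ℝ) →L[ℝ] (ι → ℝ) :=
      ContinuousLinearMap.pi fun i => ∑ k, b i k • ContinuousLinearMap.proj k
    have hL : (fun ω => (Z · ω)) = fun ω => L (X · ω) := by
      ext ω i
      simp [L, hZ]
    exact hL ▸ hX.map_fun L
  have hZc : ∀ i, ∫ ω, Z i ω ∂P = 0 := by
    intro i
    simp only [hZ]
    rw [integral_finsetSum _ fun k _ => ((hL2 k).integrable one_le_two).const_mul _]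
    simp [integral_const_mul, hc]
  have hZcov : ∀ i j, cov[Z i, Z j; P] = if i = j then hA.eigenvalues j else 0 := by
    intro i j
    simp only [hZ]
    rw [covariance_fun_sum_fun_sum (fun k => (hL2 k).const_mul _) (fun k => (hL2 k).const_mul _)]
    simp_rw [covariance_const_mul_left, covariance_const_mul_right, hcov]
    have h1 : ∀ k, ∑ l, b i k * (b j l * A k l) = b i k * (hA.eigenvalues j * b j k) := by
      intro k
      have := congrFun (hA.mulVec_eigenvectorBasis j) k
      simp only [Matrix.mulVec, dotProduct, Pi.smul_apply, smul_eq_mul] at this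
      rw [← this, Finset.mul_sum]
      exact Finset.sum_congr rfl fun l _ => by ring
    simp_rw [h1]
    have h2 := b.inner_eq_ite i j
    simp only [PiLp.inner_apply, RCLike.inner_apply, conj_trivial] at h2
    calc ∑ k, b i k * (hA.eigenvalues j * b j k)
        = hA.eigenvalues j * ∑ k, b j k * b i k := by
          rw [Finset.mul_sum]; exact Finset.sum_congr rfl fun l _ => by ring
      _ = _ := by rw [h2]; split_ifs <;> simp
  have hind : iIndepFun Z P := hZg.iIndepFun_of_covariance_eq_zero fun i j hij => by
    rw [hZcov, if_neg hij]
  have hsum : (fun ω => ∑ i, X i ω ^ 2) = fun ω => ∑ i, Z i ω ^ 2 := by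
    ext ω
    have := b.sum_sq_inner_right (WithLp.toLp 2 fun k => X k ω)
    rw [EuclideanSpace.norm_sq_eq] at this
    simp only [Real.norm_eq_abs, sq_abs] at this
    rw [← this]
    refine Finset.sum_congr rfl fun i _ => ?_
    congr 1
    simp only [PiLp.inner_apply, RCLike.inner_apply, conj_trivial, hZ]
    exact Finset.sum_congr rfl fun l _ => by ring
  have hmeas : ∀ i, AEMeasurable (Z i) P := fun i => (hZg.eval i).aemeasurable
  rw [hsum, iIndepFun.charFun_map_fun_sum_eq_prod (X := fun i ω => Z i ω ^ 2)
    (fun i => (hmeas i).pow_const 2)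
    (hind.comp (fun _ x => x ^ 2) fun _ => measurable_id.pow_const 2), Finset.prod_apply,
    Complex.exp_sum]
  refine Finset.prod_congr rfl fun i _ => ?_
  have hv : Var[Z i; P] = hA.eigenvalues i := by
    rw [← covariance_self (hmeas i), hZcov, if_pos rfl]
  have hv0 : 0 ≤ hA.eigenvalues i := hv ▸ variance_nonneg _ _
  rw [charFun_apply_real, integral_map ((hmeas i).pow_const 2) (by fun_prop)]
  have := integral_map (hmeas i) (f := fun x : ℝ => Complex.exp (t * (x ^ 2 : ℝ) * Complex.I))
    (by fun_prop)
  rw [← this, (hZg.eval i).map_eq_gaussianReal, hZc, hv, integral_cexp_sq_gaussianReal,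
    Real.coe_toNNReal _ hv0]
  push_cast
  rfl

/-- A central limit theorem for squared norms of centered Gaussian vectors. -/
theorem tendstoInDistribution_sum_sq [IsProbabilityMeasure P] {ι : ℕ → Type*}
    [∀ n, Fintype (ι n)] {X : ∀ n, ι n → Ω → ℝ}
    (hX : ∀ n, HasGaussianLaw (fun ω => (X n · ω)) P) (hc : ∀ n i, ∫ ω, X n i ω ∂P = 0)
    {A : ∀ n, ι n → ι n → ℝ} (hcov : ∀ n i j, cov[X n i, X n j; P] = A n i j)
    {v : ℝ} (hv : Tendsto (fun n => ∑ i, ∑ j, A n i j ^ 2) atTop (𝓝 v))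
    {r : ℕ → ℝ} (hr : ∀ᶠ n in atTop, ∀ i, ∑ j, |A n i j| ≤ r n) (hr0 : Tendsto r atTop (𝓝 0))
    {c : ℕ → ℝ} (hm : Tendsto (fun n => ∑ i, A n i i - c n) atTop (𝓝 0)) :
    TendstoInDistribution (fun n ω => ∑ i, X n i ω ^ 2 - c n) atTop (id : ℝ → ℝ) (fun _ => P)
      (gaussianReal 0 (2 * v).toNNReal) := by
  classical
  have hv0 : 0 ≤ v := ge_of_tendsto' hv fun n =>
    Finset.sum_nonneg fun i _ => Finset.sum_nonneg fun j _ => sq_nonneg _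
  have hXm : ∀ n i, AEMeasurable (X n i) P := fun n i => ((hX n).eval i).aemeasurable
  have hSm : ∀ n, AEMeasurable (fun ω => ∑ i, X n i ω ^ 2) P := fun n =>
    Finset.aemeasurable_fun_sum _ fun i _ => (hXm n i).pow_const 2
  refine ⟨fun n => (hSm n).sub_const _, aemeasurable_id, ?_⟩
  refine ProbabilityMeasure.tendsto_iff_tendsto_charFun.2 fun t => ?_
  have hA : ∀ n, (Matrix.of (A n)).IsHermitian := fun n => by
    ext i j
    simp [← hcov, covariance_comm]
  set ev : ∀ n, ι n → ℝ := fun n => (hA n).eigenvalues with hev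
  set g : ℝ → ℂ := fun s =>
    -(1 / 2) * Complex.log (1 + (-2 * s * Complex.I)) - s * Complex.I + s ^ 2 with hg
  have hsumsq : ∀ n, ∑ i, ev n i ^ 2 = ∑ i, ∑ j, A n i j ^ 2 := fun n => sum_eigenvalues_sq (hA n)
  have htr : ∀ n, ∑ i, ev n i = ∑ i, A n i i := fun n => by
    have := (hA n).trace_eq_sum_eigenvalues
    simp only [Matrix.trace, Matrix.diag, Matrix.of_apply] at this
    exact_mod_cast this.symm
  have hchar : ∀ n, charFun (P.map fun ω => ∑ i, X n i ω ^ 2 - c n) t =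
      Complex.exp (∑ i, g (t * ev n i) + ((t * (∑ i, A n i i - c n) : ℝ) : ℂ) * Complex.I
        - ((t ^ 2 * ∑ i, ∑ j, A n i j ^ 2 : ℝ) : ℂ)) := by
    intro n
    have h1 := charFun_sum_sq (hX n) (hc n) (A := Matrix.of (A n)) (hcov n) (hA n) t
    rw [charFun_apply_real, integral_map (hSm n) (by fun_prop)] at h1
    rw [charFun_apply_real, integral_map ((hSm n).sub_const _) (by fun_prop)]
    have h2 : ∀ ω, Complex.exp (t * ((∑ i, X n i ω ^ 2 - c n : ℝ) : ℂ) * Complex.I) =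
        Complex.exp (t * ((∑ i, X n i ω ^ 2 : ℝ) : ℂ) * Complex.I) *
          Complex.exp (-(t * c n * Complex.I)) := by
      intro ω
      rw [← Complex.exp_add]; congr 1; push_cast; ring
    simp_rw [h2]
    rw [integral_mul_const, h1, ← Complex.exp_add]
    congr 1
    rw [← hsumsq, ← htr]
    push_cast
    simp only [hg, hev, Finset.sum_sub_distrib, Finset.sum_add_distrib, mul_sub, sub_mul,
      Finset.mul_sum, Finset.sum_mul]
    push_cast
    simp only [mul_pow]
    ring
  -- The cubic remainder costs 3|t|³ |λ|³ ≤ 3|t|³ r λ², and Σ λ² stays bounded while r tends to 0.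
  have hgto : Tendsto (fun n => ∑ i, g (t * ev n i)) atTop (𝓝 0) := by
    have hb : Tendsto (fun n => 3 * |t| ^ 3 * (r n * ∑ i, ∑ j, A n i j ^ 2)) atTop (𝓝 0) := by
      simpa using (hr0.mul hv).const_mul (3 * |t| ^ 3)
    refine squeeze_zero_norm' ?_ hb
    have hsm : Tendsto (fun n => |t| * r n) atTop (𝓝 0) := by simpa using hr0.const_mul |t|
    filter_upwards [hr, hsm.eventually (ge_mem_nhds (show (0 : ℝ) < 1 / 4 by norm_num))]
      with n hn hn'
    rw [← hsumsq, Finset.mul_sum, Finset.mul_sum]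
    refine norm_sum_le_of_le _ fun i _ => ?_
    have he : |ev n i| ≤ r n := abs_eigenvalues_le (hA n) (by simpa using hn) i
    have hle : |t * ev n i| ≤ 1 / 4 := by
      rw [abs_mul]
      exact (mul_le_mul_of_nonneg_left he (abs_nonneg t)).trans hn'
    have h3 := norm_log_sub_le (t * ev n i) hle
    have h4 : ‖g (t * ev n i)‖ ≤ 3 * |t * ev n i| ^ 3 := by
      simpa only [hg] using h3
    refine h4.trans ?_
    rw [abs_mul, mul_pow, ← mul_assoc]
    refine mul_le_mul_of_nonneg_left ?_ (by positivity)
    rw [pow_succ', sq_abs]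
    exact mul_le_mul_of_nonneg_right he (sq_nonneg _)
  have hlim : charFun ((gaussianReal 0 (2 * v).toNNReal).map (id : ℝ → ℝ)) t =
      Complex.exp (0 + ((t * 0 : ℝ) : ℂ) * Complex.I - ((t ^ 2 * v : ℝ) : ℂ)) := by
    rw [Measure.map_id, charFun_gaussianReal, Real.coe_toNNReal _ (by linarith)]
    congr 1
    push_cast
    ring
  change Tendsto (fun n => charFun (P.map fun ω => ∑ i, X n i ω ^ 2 - c n) t) atTop
    (𝓝 (charFun ((gaussianReal 0 (2 * v).toNNReal).map (id : ℝ → ℝ)) t))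
  rw [hlim]
  simp_rw [hchar]
  refine (Complex.continuous_exp.tendsto _).comp ((hgto.add ?_).sub ?_)
  · exact ((Complex.continuous_ofReal.tendsto _).comp (hm.const_mul t)).mul_const _
  · exact (Complex.continuous_ofReal.tendsto _).comp (hv.const_mul (t ^ 2))


/-! ### Fourth differences of |x|^p and the integrals ρ. -/

/-- The fourth-order central difference of `x ↦ |x| ^ p`. -/
noncomputable def fourthDiff (p x : ℝ) : ℝ :=
  |x + 2| ^ p - 4 * |x + 1| ^ p + 6 * |x| ^ p - 4 * |x - 1| ^ p + |x - 2| ^ p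

lemma fourthDiff_neg (p x : ℝ) : fourthDiff p (-x) = fourthDiff p x := by
  have h1 : |-x + 2| = |x - 2| := by rw [← abs_neg]; congr 1; ring
  have h2 : |-x + 1| = |x - 1| := by rw [← abs_neg]; congr 1; ring
  have h3 : |-x - 1| = |x + 1| := by rw [← abs_neg]; congr 1; ring
  have h4 : |-x - 2| = |x + 2| := by rw [← abs_neg]; congr 1; ring
  rw [fourthDiff, fourthDiff, h1, h2, h3, h4, abs_neg]
  ring

lemma fourthDiff_zero {p : ℝ} (hp : 0 < p) : fourthDiff p 0 = -(2 * (4 - 2 ^ p)) := by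
  simp only [fourthDiff, zero_add, zero_sub, abs_neg, abs_zero, abs_one, abs_two, Real.one_rpow,
    Real.zero_rpow hp.ne']
  ring

lemma fourthDiff_one {p : ℝ} (hp : 0 < p) : fourthDiff p 1 = -(2 ^ (p + 2) - 7 - 3 ^ p) := by
  have h3 : |(1 : ℝ) + 2| = 3 := by norm_num
  have h2 : |(1 : ℝ) + 1| = 2 := by norm_num
  have h1 : |(1 : ℝ) - 2| = 1 := by norm_num
  rw [fourthDiff, h3, h2, h1, sub_self, abs_one, abs_zero, Real.one_rpow, Real.zero_rpow hp.ne',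
    Real.rpow_add (by norm_num)]
  norm_num
  ring

/-- Keeping r + 1 as a factor covers r = -1, where both sides vanish; this exponent occurs below
when p = 1. -/
lemma mul_integral_rpow {a b r : ℝ} (h : -1 < r ∨ (0 : ℝ) ∉ Set.uIcc a b) :
    (r + 1) * ∫ x in a..b, x ^ r = b ^ (r + 1) - a ^ (r + 1) := by
  by_cases hr : r + 1 = 0
  · simp [hr]
  · rw [integral_rpow (h.imp_right fun h => ⟨fun e => hr (by rw [e]; ring), h⟩)]
    field_simp

lemma mul_integral_rpow_sub_left {a b d r : ℝ} (hab : a ≤ b) (hd : b < d) :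
    (r + 1) * ∫ x in a..b, (d - x) ^ r = (d - a) ^ (r + 1) - (d - b) ^ (r + 1) := by
  rw [intervalIntegral.integral_comp_sub_left (fun x => x ^ r) d, mul_integral_rpow]
  right
  rw [Set.uIcc_of_le (by linarith), Set.mem_Icc]
  intro h
  linarith [h.1]

lemma intervalIntegrable_rpow_sub_left {a b d r : ℝ} (hab : a ≤ b) (hd : b < d) :
    IntervalIntegrable (fun x => (d - x) ^ r) volume a b := by
  refine ContinuousOn.intervalIntegrable fun x hx => ContinuousAt.continuousWithinAt ?_
  rw [Set.uIcc_of_le hab] at hx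
  exact (continuousAt_const.sub continuousAt_id).rpow_const (Or.inl
    (sub_pos.2 (hx.2.trans_lt hd)).ne')

lemma mul_integral_rpow_add {a b d r : ℝ} (h : -1 < r ∨ (a ≤ b ∧ 0 < a + d)) :
    (r + 1) * ∫ x in a..b, (x + d) ^ r = (b + d) ^ (r + 1) - (a + d) ^ (r + 1) := by
  rw [intervalIntegral.integral_comp_add_right (fun x => x ^ r) d, mul_integral_rpow]
  refine h.imp_right fun h => ?_
  rw [Set.uIcc_of_le (by linarith), Set.mem_Icc]
  intro h'
  linarith [h'.1]

lemma intervalIntegrable_rpow_add {a b d r : ℝ} (h : -1 < r ∨ (a ≤ b ∧ 0 < a + d)) :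
    IntervalIntegrable (fun x => (x + d) ^ r) volume a b := by
  rcases h with h | ⟨hab, hd⟩
  · have := (intervalIntegral.intervalIntegrable_rpow' (a := a + d) (b := b + d) h).comp_add_right d
    simpa using this
  · refine ContinuousOn.intervalIntegrable fun x hx => ContinuousAt.continuousWithinAt ?_
    rw [Set.uIcc_of_le hab] at hx
    exact (continuousAt_id.add continuousAt_const).rpow_const (Or.inl
      (by linarith [hx.1] : 0 < x + d).ne')

lemma mul_integral_inner (p : ℝ) {v x : ℝ} (h : x < v) :
    (p - 3) * ∫ y in (x - 1)..x, 1 / (v - y) ^ (2 + (2 - p)) =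
      (v + 1 - x) ^ (p - 3) - (v - x) ^ (p - 3) := by
  have e : ∫ y in (x - 1)..x, 1 / (v - y) ^ (2 + (2 - p)) = ∫ y in (x - 1)..x, (v - y) ^ (p - 4) := by
    refine intervalIntegral.integral_congr fun y hy => ?_
    rw [Set.uIcc_of_le (by linarith)] at hy
    have : 0 ≤ v - y := by linarith [hy.2]
    rw [show p - 4 = -(2 + (2 - p)) by ring, Real.rpow_neg this, one_div]
  rw [e, show p - 3 = p - 4 + 1 by ring, mul_integral_rpow_sub_left (by linarith) h]
  congr 2
  ring

/-- Each integration raises the exponent by one and absorbs one factor of p(p-1)(p-2)(p-3). The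
shape `v + d`, even for d = 0, lets a single formula treat all terms at the next stage. -/
lemma mul_integral_inner₂ (p : ℝ) {v : ℝ} (h : 1 < v) :
    (p - 2) * (p - 3) * ∫ x in (0 : ℝ)..1, ∫ y in (x - 1)..x, 1 / (v - y) ^ (2 + (2 - p)) =
      (v + 1) ^ (p - 2) - 2 * (v + 0) ^ (p - 2) + (v + -1) ^ (p - 2) := by
  rw [mul_assoc, ← intervalIntegral.integral_const_mul]
  have e : ∫ x in (0 : ℝ)..1, (p - 3) * ∫ y in (x - 1)..x, 1 / (v - y) ^ (2 + (2 - p)) =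
      ∫ x in (0 : ℝ)..1, ((v + 1 - x) ^ (p - 3) - (v - x) ^ (p - 3)) := by
    refine intervalIntegral.integral_congr fun x hx => ?_
    rw [Set.uIcc_of_le zero_le_one] at hx
    exact mul_integral_inner p (by linarith [hx.2])
  rw [e, intervalIntegral.integral_sub
    (intervalIntegrable_rpow_sub_left zero_le_one (by linarith))
    (intervalIntegrable_rpow_sub_left zero_le_one h), mul_sub, show p - 2 = p - 3 + 1 by ring,
    mul_integral_rpow_sub_left zero_le_one (by linarith), mul_integral_rpow_sub_left zero_le_one h]
  simp only [sub_zero, add_sub_cancel_right, add_zero, ← sub_eq_add_neg]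
  ring

lemma mul_integral_inner₃ (p : ℝ) {u : ℝ} (h : 2 < u) :
    (p - 1) * (p - 2) * (p - 3) * ∫ v in (u - 1)..u, ∫ x in (0 : ℝ)..1, ∫ y in (x - 1)..x,
        1 / (v - y) ^ (2 + (2 - p)) =
      (u + 1) ^ (p - 1) - 3 * (u + 0) ^ (p - 1) + 3 * (u + -1) ^ (p - 1) - (u + -2) ^ (p - 1) := by
  rw [mul_assoc (p - 1), mul_assoc (p - 1), ← intervalIntegral.integral_const_mul]
  have e : ∫ v in (u - 1)..u, (p - 2) * (p - 3) * ∫ x in (0 : ℝ)..1, ∫ y in (x - 1)..x,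
        1 / (v - y) ^ (2 + (2 - p)) =
      ∫ v in (u - 1)..u, ((v + 1) ^ (p - 2) - 2 * (v + 0) ^ (p - 2) + (v + -1) ^ (p - 2)) := by
    refine intervalIntegral.integral_congr fun x hx => ?_
    rw [Set.uIcc_of_le (by linarith)] at hx
    exact mul_integral_inner₂ p (by linarith [hx.1])
  have i (d : ℝ) (hd : -1 ≤ d) :
      IntervalIntegrable (fun v => (v + d) ^ (p - 2)) volume (u - 1) u :=
    intervalIntegrable_rpow_add (Or.inr ⟨by linarith, by linarith⟩)
  have j (d : ℝ) (hd : -1 ≤ d) :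
      (p - 1) * ∫ v in (u - 1)..u, (v + d) ^ (p - 2) = (u + d) ^ (p - 1) - (u - 1 + d) ^ (p - 1) := by
    have := mul_integral_rpow_add (a := u - 1) (b := u) (d := d) (r := p - 2)
      (Or.inr ⟨by linarith, by linarith⟩)
    rwa [show p - 2 + 1 = p - 1 by ring] at this
  rw [e, intervalIntegral.integral_add
      ((i 1 (by norm_num)).sub ((i 0 (by norm_num)).const_mul 2)) (i (-1) le_rfl),
    intervalIntegral.integral_sub (i 1 (by norm_num)) ((i 0 (by norm_num)).const_mul 2),
    intervalIntegral.integral_const_mul, mul_add, mul_sub, mul_left_comm (p - 1) 2,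
    j 1 (by norm_num), j 0 (by norm_num), j (-1) le_rfl]
  rw [show u - 1 + 1 = u + 0 by ring, show u - 1 + 0 = u + -1 by ring,
    show u - 1 + -1 = u + -2 by ring]
  ring

lemma fourthDiff_eq_rho {p : ℝ} (hp : 0 < p) {l : ℕ} (hl : 2 ≤ l) :
    fourthDiff p l = p * (p - 1) * (p - 2) * (p - 3) * rho (2 - p) l := by
  have hl' : (2 : ℝ) ≤ l := by exact_mod_cast hl
  rw [rho, rho₂, mul_assoc p (p - 1), mul_assoc p, mul_assoc p, ← intervalIntegral.integral_const_mul]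
  simp only [Int.cast_natCast, Int.cast_zero, zero_add]
  have e : ∫ u in (l : ℝ)..(l + 1), (p - 1) * (p - 2) * (p - 3) * ∫ v in (u - 1)..u,
        ∫ x in (0 : ℝ)..1, ∫ y in (x - 1)..x, 1 / (v - y) ^ (2 + (2 - p)) =
      ∫ u in (l : ℝ)..(l + 1), ((u + 1) ^ (p - 1) - 3 * (u + 0) ^ (p - 1) +
        3 * (u + -1) ^ (p - 1) - (u + -2) ^ (p - 1)) := by
    -- For l = 2 the left endpoint u = 2 escapes `mul_integral_inner₃`; the half-open interval
    -- leaves it out.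
    refine intervalIntegral.integral_congr_ae (ae_of_all _ fun u hu => ?_)
    rw [Set.uIoc_of_le (by linarith)] at hu
    exact mul_integral_inner₃ p (by linarith [hu.1])
  -- When l = 2 and d = -2 the integrand may blow up at the left endpoint, but p - 1 > -1 keeps it
  -- integrable.
  have i (d : ℝ) : IntervalIntegrable (fun v => (v + d) ^ (p - 1)) volume (l : ℝ) (l + 1) :=
    intervalIntegrable_rpow_add (Or.inl (by linarith))
  have j (d : ℝ) : p * ∫ v in (l : ℝ)..(l + 1), (v + d) ^ (p - 1) =
      (l + 1 + d) ^ p - (l + d) ^ p := by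
    have := mul_integral_rpow_add (a := l) (b := l + 1) (d := d) (r := p - 1)
      (Or.inl (by linarith))
    rwa [sub_add_cancel] at this
  rw [e, intervalIntegral.integral_sub
      (((i 1).sub ((i 0).const_mul 3)).add ((i (-1)).const_mul 3)) (i (-2)),
    intervalIntegral.integral_add ((i 1).sub ((i 0).const_mul 3)) ((i (-1)).const_mul 3),
    intervalIntegral.integral_sub (i 1) ((i 0).const_mul 3),
    intervalIntegral.integral_const_mul, intervalIntegral.integral_const_mul, mul_sub, mul_add,
    mul_sub, mul_left_comm p 3, mul_left_comm p 3, j, j, j, j, fourthDiff,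
    abs_of_nonneg (by linarith : (0 : ℝ) ≤ l + 2), abs_of_nonneg (by linarith : (0 : ℝ) ≤ l + 1),
    abs_of_nonneg (by linarith : (0 : ℝ) ≤ l), abs_of_nonneg (by linarith : (0 : ℝ) ≤ l - 1),
    abs_of_nonneg (by linarith : (0 : ℝ) ≤ l - 2)]
  rw [show (l : ℝ) + 1 + 1 = l + 2 by ring, show (l : ℝ) + 1 + 0 = l + 1 by ring,
    show (l : ℝ) + 0 = l by ring, show (l : ℝ) + 1 + -1 = l by ring,
    show (l : ℝ) + 1 + -2 = l - 1 by ring, show (l : ℝ) + -1 = l - 1 by ring,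
    show (l : ℝ) + -2 = l - 2 by ring]
  ring

/-- All four intervals have length 1, and v - y ≥ l + 1 on the domain. The shift by 3 avoids `rho γ
2`, whose integrand is singular. -/
lemma abs_rho_le {γ : ℝ} (hγ : 0 < γ) (l : ℕ) :
    |rho γ (l + 3)| ≤ 1 / ((l : ℝ) + 1) ^ (2 + γ) := by
  set C : ℝ := 1 / ((l : ℝ) + 1) ^ (2 + γ) with hC
  have hl : (0 : ℝ) ≤ l := l.cast_nonneg
  rw [rho, rho₂, ← Real.norm_eq_abs]
  simp only [Int.cast_natCast, Int.cast_zero, zero_add]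
  push_cast
  have key : ∀ (f : ℝ → ℝ) (a b : ℝ), b - a = 1 → (∀ x ∈ Set.Ioc a b, ‖f x‖ ≤ C) →
      ‖∫ x in a..b, f x‖ ≤ C := by
    intro f a b hab h
    have := intervalIntegral.norm_integral_le_of_norm_le_const (f := f) (a := a) (b := b) (C := C)
      (by rwa [Set.uIoc_of_le (by linarith)])
    simpa [hab] using this
  refine key _ _ _ (by ring) fun u hu => key _ _ _ (by ring) fun v hv => key _ _ _ (by ring)
    fun x hx => key _ _ _ (by ring) fun y hy => ?_
  have h : (l : ℝ) + 1 ≤ v - y := by linarith [hu.1, hv.1, hx.2, hy.2]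
  have h0 : (0 : ℝ) < (l : ℝ) + 1 := by linarith
  rw [Real.norm_of_nonneg (one_div_nonneg.2 (Real.rpow_nonneg (h0.le.trans h) _)), hC]
  exact one_div_le_one_div_of_le (Real.rpow_pos_of_pos h0 _)
    (Real.rpow_le_rpow h0.le h (by linarith))

lemma summable_one_div_add_one_rpow {s : ℝ} (hs : 1 < s) :
    Summable fun l : ℕ => 1 / ((l : ℝ) + 1) ^ s := by
  have := (summable_nat_add_iff 1).2 (Real.summable_one_div_nat_rpow.2 hs)
  simpa using this

lemma summable_abs_rho {γ : ℝ} (hγ : 0 < γ) : Summable fun l : ℕ => |rho γ (l + 2)| := by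
  rw [← summable_nat_add_iff 1]
  exact Summable.of_nonneg_of_le (fun _ => abs_nonneg _) (fun l => abs_rho_le hγ l)
    (summable_one_div_add_one_rpow (by linarith))

lemma summable_rho_sq {γ : ℝ} (hγ : 0 < γ) : Summable fun l : ℕ => rho γ (l + 2) ^ 2 := by
  have h := summable_abs_rho hγ
  have h2 := h.mul_of_nonneg h (fun _ => abs_nonneg _) (fun _ => abs_nonneg _)
  refine (h2.comp_injective (i := fun l : ℕ => (l, l)) fun a b h => (Prod.ext_iff.1 h).1).congr ?_
  intro l
  simp [← sq]

lemma summable_abs_fourthDiff {p : ℝ} (hp : 0 < p) (hp2 : p < 2) :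
    Summable fun m : ℤ => |fourthDiff p m| := by
  have h : Summable fun l : ℕ => |fourthDiff p l| := by
    rw [← summable_nat_add_iff 2]
    refine ((summable_abs_rho (γ := 2 - p) (by linarith)).mul_left
      |p * (p - 1) * (p - 2) * (p - 3)|).congr fun l => ?_
    rw [← abs_mul, ← fourthDiff_eq_rho hp (by lia)]
  refine Summable.of_nat_of_neg (by simpa using h) ?_
  simpa [fourthDiff_neg] using h

/-- Lag 1 is out of reach of the integral formula and enters by its explicit value; the lags from 2
on give the ρ-series. -/
lemma tsum_fourthDiff_sq {p : ℝ} (hp : 0 < p) (hp2 : p < 2) :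
    Summable (fun l : ℕ => fourthDiff p ((l : ℝ) + 1) ^ 2) ∧
    ∑' l : ℕ, fourthDiff p ((l : ℝ) + 1) ^ 2 = (2 ^ (p + 2) - 7 - 3 ^ p) ^ 2
      + p ^ 2 * (p - 1) ^ 2 * (p - 2) ^ 2 * (p - 3) ^ 2 * rhoNormSq (2 - p) := by
  have hs := (summable_rho_sq (γ := 2 - p) (by linarith)).mul_left
    (p ^ 2 * (p - 1) ^ 2 * (p - 2) ^ 2 * (p - 3) ^ 2)
  have e : ∀ l : ℕ, p ^ 2 * (p - 1) ^ 2 * (p - 2) ^ 2 * (p - 3) ^ 2 * rho (2 - p) (l + 2) ^ 2 =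
      fourthDiff p (((l + 1 : ℕ) : ℝ) + 1) ^ 2 := by
    intro l
    have := fourthDiff_eq_rho hp (l := l + 2) (by lia)
    rw [show ((l + 1 : ℕ) : ℝ) + 1 = ((l + 2 : ℕ) : ℝ) by push_cast; ring, this]
    ring
  have hsum : Summable fun l : ℕ => fourthDiff p ((l : ℝ) + 1) ^ 2 :=
    (summable_nat_add_iff 1).1 (hs.congr e)
  refine ⟨hsum, ?_⟩
  rw [hsum.tsum_eq_zero_add, ← tsum_congr e, tsum_mul_left, rhoNormSq]
  simp only [Nat.cast_zero, zero_add, fourthDiff_one hp]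
  ring


/-! ### The smooth part of the covariance and its mixed second differences. -/

/-- The second-order central difference of `f` at `x` with step `δ`. -/
def secondDiff (f : ℝ → ℝ) (x δ : ℝ) : ℝ := f (x + δ) + f (x - δ) - 2 * f x

/-- The mean value inequality is used twice: τ ↦ g(x+τ) + g(x-τ) has derivative g'(x+τ) - g'(x-τ),
itself at most 2Cδ in size. -/
lemma abs_secondDiff_le {g g' g'' : ℝ → ℝ} {α β C x δ : ℝ}
    (hg : ∀ s ∈ Set.Icc α β, HasDerivAt g (g' s) s)
    (hg' : ∀ s ∈ Set.Icc α β, HasDerivAt g' (g'' s) s)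
    (hC : ∀ s ∈ Set.Icc α β, |g'' s| ≤ C) (hδ : 0 ≤ δ) (h₁ : α ≤ x - δ) (h₂ : x + δ ≤ β) :
    |secondDiff g x δ| ≤ 2 * C * δ ^ 2 := by
  have hmem : ∀ τ ∈ Set.Icc 0 δ, x + τ ∈ Set.Icc α β ∧ x - τ ∈ Set.Icc α β := fun τ hτ =>
    ⟨⟨by linarith [hτ.1], by linarith [hτ.2]⟩, ⟨by linarith [hτ.2], by linarith [hτ.1]⟩⟩
  have hC0 : 0 ≤ C := (abs_nonneg _).trans (hC x ⟨by linarith, by linarith⟩)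
  have hb : ∀ τ ∈ Set.Icc 0 δ, ‖g' (x + τ) - g' (x - τ)‖ ≤ 2 * C * δ := by
    intro τ hτ
    have := (convex_Icc α β).norm_image_sub_le_of_norm_hasDerivWithin_le
      (fun s hs => (hg' s hs).hasDerivWithinAt) hC (hmem τ hτ).2 (hmem τ hτ).1
    refine this.trans ?_
    rw [Real.norm_eq_abs, show x + τ - (x - τ) = 2 * τ by ring,
      abs_of_nonneg (by linarith [hτ.1])]
    nlinarith [hτ.2]
  have hd : ∀ τ ∈ Set.Icc 0 δ, HasDerivWithinAt (fun τ => g (x + τ) + g (x - τ))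
      (g' (x + τ) - g' (x - τ)) (Set.Icc 0 δ) τ := by
    intro τ hτ
    have h1 : HasDerivAt (fun τ => g (x + τ)) (g' (x + τ)) τ :=
      (hg _ (hmem τ hτ).1).comp_const_add x τ
    have h2 : HasDerivAt (fun τ => g (x - τ)) (-g' (x - τ)) τ :=
      (hg _ (hmem τ hτ).2).comp_const_sub x τ
    exact ((h1.add h2).congr_deriv (sub_eq_add_neg _ _).symm).hasDerivWithinAt
  have := (convex_Icc 0 δ).norm_image_sub_le_of_norm_hasDerivWithin_le hd hb
    (Set.left_mem_Icc.2 hδ) (Set.right_mem_Icc.2 hδ)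
  rw [Real.norm_eq_abs, Real.norm_eq_abs, sub_zero, sub_zero, add_zero,
    abs_of_nonneg hδ] at this
  rw [secondDiff, two_mul]
  exact this.trans (le_of_eq (by ring))

/-- The functions `s ^ a * t ^ b * (s ^ p + t ^ p) ^ e`, a class closed under partial
derivatives up to linear combinations. -/
noncomputable def powSum (p a b e s t : ℝ) : ℝ := s ^ a * t ^ b * (s ^ p + t ^ p) ^ e

/-- The first partial derivative of `powSum` in the first variable. -/
noncomputable def powSumDeriv (p a b e s t : ℝ) : ℝ :=
  a * powSum p (a - 1) b e s t + e * p * powSum p (a - 1 + p) b (e - 1) s t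

/-- The second partial derivative of `powSum` in the first variable. -/
noncomputable def powSumDeriv₂ (p a b e s t : ℝ) : ℝ :=
  a * powSumDeriv p (a - 1) b e s t + e * p * powSumDeriv p (a - 1 + p) b (e - 1) s t

lemma powSum_comm (p a b e s t : ℝ) : powSum p a b e s t = powSum p b a e t s := by
  rw [powSum, powSum, mul_comm (s ^ a), add_comm (s ^ p)]

lemma hasDerivAt_powSum (p a b e : ℝ) {s t : ℝ} (hs : 0 < s) (ht : 0 < t) :
    HasDerivAt (fun s => powSum p a b e s t) (powSumDeriv p a b e s t) s := by
  have hpos : 0 < s ^ p + t ^ p := add_pos (Real.rpow_pos_of_pos hs _) (Real.rpow_pos_of_pos ht _)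
  have h1 := (Real.hasDerivAt_rpow_const (x := s) (p := a) (Or.inl hs.ne')).mul_const (t ^ b)
  have h2 := ((Real.hasDerivAt_rpow_const (x := s) (p := p) (Or.inl hs.ne')).add_const
    (t ^ p)).rpow_const (p := e) (Or.inl hpos.ne')
  refine (h1.mul h2).congr_deriv ?_
  rw [powSumDeriv, powSum, powSum, show a - 1 + p = a + (p - 1) by ring, Real.rpow_add hs a]
  ring

lemma hasDerivAt_powSumDeriv (p a b e : ℝ) {s t : ℝ} (hs : 0 < s) (ht : 0 < t) :
    HasDerivAt (fun s => powSumDeriv p a b e s t) (powSumDeriv₂ p a b e s t) s :=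
  ((hasDerivAt_powSum p (a - 1) b e hs ht).const_mul a).add
    ((hasDerivAt_powSum p (a - 1 + p) b (e - 1) hs ht).const_mul (e * p))

lemma exists_abs_powSum_le (p a b e : ℝ) {α : ℝ} (hα : 0 < α) (β : ℝ) :
    ∃ C, ∀ s ∈ Set.Icc α β, ∀ t ∈ Set.Icc α β, |powSum p a b e s t| ≤ C := by
  have hc : ContinuousOn (fun q : ℝ × ℝ => powSum p a b e q.1 q.2) (Set.Icc α β ×ˢ Set.Icc α β) := by
    intro q hq
    have h1 : 0 < q.1 := hα.trans_le hq.1.1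
    have h2 : 0 < q.2 := hα.trans_le hq.2.1
    have hpos : 0 < q.1 ^ p + q.2 ^ p :=
      add_pos (Real.rpow_pos_of_pos h1 _) (Real.rpow_pos_of_pos h2 _)
    have c1 (r : ℝ) : ContinuousAt (fun q : ℝ × ℝ => q.1 ^ r) q :=
      continuousAt_fst.rpow_const (Or.inl h1.ne')
    have c2 (r : ℝ) : ContinuousAt (fun q : ℝ × ℝ => q.2 ^ r) q :=
      continuousAt_snd.rpow_const (Or.inl h2.ne')
    exact (((c1 a).mul (c2 b)).mul
      (((c1 p).add (c2 p)).rpow_const (Or.inl hpos.ne'))).continuousWithinAt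
  obtain ⟨C, hC⟩ := (isCompact_Icc.prod isCompact_Icc).exists_bound_of_continuousOn hc
  exact ⟨C, fun s hs t ht => hC (s, t) ⟨hs, ht⟩⟩

lemma exists_abs_powSumDeriv_le (p a b e : ℝ) {α : ℝ} (hα : 0 < α) (β : ℝ) :
    ∃ C, ∀ s ∈ Set.Icc α β, ∀ t ∈ Set.Icc α β, |powSumDeriv p a b e s t| ≤ C := by
  obtain ⟨C₁, h₁⟩ := exists_abs_powSum_le p (a - 1) b e hα β
  obtain ⟨C₂, h₂⟩ := exists_abs_powSum_le p (a - 1 + p) b (e - 1) hα β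
  refine ⟨|a| * C₁ + |e * p| * C₂, fun s hs t ht => (abs_add_le _ _).trans ?_⟩
  rw [abs_mul, abs_mul (e * p)]
  gcongr
  exacts [h₁ s hs t ht, h₂ s hs t ht]

lemma exists_abs_powSumDeriv₂_le (p a b e : ℝ) {α : ℝ} (hα : 0 < α) (β : ℝ) :
    ∃ C, ∀ s ∈ Set.Icc α β, ∀ t ∈ Set.Icc α β, |powSumDeriv₂ p a b e s t| ≤ C := by
  obtain ⟨C₁, h₁⟩ := exists_abs_powSumDeriv_le p (a - 1) b e hα β
  obtain ⟨C₂, h₂⟩ := exists_abs_powSumDeriv_le p (a - 1 + p) b (e - 1) hα β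
  refine ⟨|a| * C₁ + |e * p| * C₂, fun s hs t ht => (abs_add_le _ _).trans ?_⟩
  rw [abs_mul, abs_mul (e * p)]
  gcongr
  exacts [h₁ s hs t ht, h₂ s hs t ht]

lemma exists_abs_secondDiff_powSum_le (p a b e : ℝ) {α : ℝ} (hα : 0 < α) (β : ℝ) :
    ∃ C, ∀ s ∈ Set.Icc α β, ∀ t δ, 0 ≤ δ → α ≤ t - δ → t + δ ≤ β →
      |secondDiff (powSum p a b e s) t δ| ≤ C * δ ^ 2 := by
  obtain ⟨C, hC⟩ := exists_abs_powSumDeriv₂_le p b a e hα β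
  refine ⟨2 * C, fun s hs t δ hδ h₁ h₂ => ?_⟩
  have hs0 := hα.trans_le hs.1
  -- Symmetry turns differences in the second variable into differences in the first, where the
  -- derivatives are available.
  have e1 : powSum p a b e s = fun t => powSum p b a e t s := funext fun t => powSum_comm _ _ _ _ _ _
  rw [e1]
  exact abs_secondDiff_le (fun t ht => hasDerivAt_powSum p b a e (hα.trans_le ht.1) hs0)
    (fun t ht => hasDerivAt_powSumDeriv p b a e (hα.trans_le ht.1) hs0)
    (fun t ht => hC t ht s hs) hδ h₁ h₂

lemma exists_abs_secondDiff_powSumDeriv_le (p a b e : ℝ) {α : ℝ} (hα : 0 < α) (β : ℝ) :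
    ∃ C, ∀ s ∈ Set.Icc α β, ∀ t δ, 0 ≤ δ → α ≤ t - δ → t + δ ≤ β →
      |secondDiff (powSumDeriv p a b e s) t δ| ≤ C * δ ^ 2 := by
  obtain ⟨C₁, h₁⟩ := exists_abs_secondDiff_powSum_le p (a - 1) b e hα β
  obtain ⟨C₂, h₂⟩ := exists_abs_secondDiff_powSum_le p (a - 1 + p) b (e - 1) hα β
  refine ⟨|a| * C₁ + |e * p| * C₂, fun s hs t δ hδ ht ht' => ?_⟩
  have : secondDiff (powSumDeriv p a b e s) t δ =
      a * secondDiff (powSum p (a - 1) b e s) t δ +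
        e * p * secondDiff (powSum p (a - 1 + p) b (e - 1) s) t δ := by
    simp only [secondDiff, powSumDeriv]; ring
  rw [this, add_mul, mul_assoc |a|, mul_assoc |e * p|]
  refine (abs_add_le _ _).trans ?_
  rw [abs_mul, abs_mul (e * p)]
  gcongr
  exacts [h₁ s hs t δ hδ ht ht', h₂ s hs t δ hδ ht ht']

lemma exists_abs_secondDiff_powSumDeriv₂_le (p a b e : ℝ) {α : ℝ} (hα : 0 < α) (β : ℝ) :
    ∃ C, ∀ s ∈ Set.Icc α β, ∀ t δ, 0 ≤ δ → α ≤ t - δ → t + δ ≤ β →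
      |secondDiff (powSumDeriv₂ p a b e s) t δ| ≤ C * δ ^ 2 := by
  obtain ⟨C₁, h₁⟩ := exists_abs_secondDiff_powSumDeriv_le p (a - 1) b e hα β
  obtain ⟨C₂, h₂⟩ := exists_abs_secondDiff_powSumDeriv_le p (a - 1 + p) b (e - 1) hα β
  refine ⟨|a| * C₁ + |e * p| * C₂, fun s hs t δ hδ ht ht' => ?_⟩
  have : secondDiff (powSumDeriv₂ p a b e s) t δ =
      a * secondDiff (powSumDeriv p (a - 1) b e s) t δ +
        e * p * secondDiff (powSumDeriv p (a - 1 + p) b (e - 1) s) t δ := by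
    simp only [secondDiff, powSumDeriv₂]; ring
  rw [this, add_mul, mul_assoc |a|, mul_assoc |e * p|]
  refine (abs_add_le _ _).trans ?_
  rw [abs_mul, abs_mul (e * p)]
  gcongr
  exacts [h₁ s hs t δ hδ ht ht', h₂ s hs t δ hδ ht ht']

/-- The mixed second difference of `powSum` is of fourth order in the step. -/
lemma exists_abs_secondDiff_secondDiff_powSum_le (p a b e : ℝ) {α : ℝ} (hα : 0 < α) (β : ℝ) :
    ∃ C, ∀ s t δ, 0 ≤ δ → α ≤ s - δ → s + δ ≤ β → α ≤ t - δ → t + δ ≤ β →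
      |secondDiff (fun s => secondDiff (powSum p a b e s) t δ) s δ| ≤ C * δ ^ 4 := by
  obtain ⟨C, hC⟩ := exists_abs_secondDiff_powSumDeriv₂_le p a b e hα β
  refine ⟨2 * C, fun s t δ hδ hs hs' ht ht' => ?_⟩
  have hp : 0 < t - δ := hα.trans_le ht
  -- Differencing in t commutes with differentiating in s: the second s-derivative of the
  -- t-difference is the t-difference of `powSumDeriv₂`, already O(δ²), and differencing in s gains
  -- another δ².
  have hd {s : ℝ} (hs : s ∈ Set.Icc α β) :
      HasDerivAt (fun s => secondDiff (powSum p a b e s) t δ)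
        (secondDiff (powSumDeriv p a b e s) t δ) s := by
    have h0 : 0 < s := hα.trans_le hs.1
    exact ((hasDerivAt_powSum p a b e h0 (by linarith)).add
      (hasDerivAt_powSum p a b e h0 hp)).sub
      ((hasDerivAt_powSum p a b e h0 (by linarith)).const_mul 2)
  have hd' {s : ℝ} (hs : s ∈ Set.Icc α β) :
      HasDerivAt (fun s => secondDiff (powSumDeriv p a b e s) t δ)
        (secondDiff (powSumDeriv₂ p a b e s) t δ) s := by
    have h0 : 0 < s := hα.trans_le hs.1
    exact ((hasDerivAt_powSumDeriv p a b e h0 (by linarith)).add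
      (hasDerivAt_powSumDeriv p a b e h0 hp)).sub
      ((hasDerivAt_powSumDeriv p a b e h0 (by linarith)).const_mul 2)
  refine (abs_secondDiff_le (fun s hs => hd hs) (fun s hs => hd' hs)
    (fun s hs => hC s hs t δ hδ ht ht') hδ hs hs').trans (le_of_eq (by ring))

/-- The covariance of two second-order increments of two-parameter fractional Brownian motion
over the grid `T + j δ`. -/
lemma cov_increment {Ω : Type*} [MeasurableSpace Ω] {H K : ℝ} {B : ℝ → Ω → ℝ}
    {P : Measure Ω} [IsProbabilityMeasure P] (hB : IsTwoParamFBM H K B P) {T δ : ℝ} (hδ : 0 ≤ δ)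
    {j k : ℝ} (hj : 0 < T + j * δ - δ) (hk : 0 < T + k * δ - δ) :
    cov[fun ω => B (T + j * δ + δ) ω + B (T + j * δ - δ) ω - 2 * B (T + j * δ) ω,
        fun ω => B (T + k * δ + δ) ω + B (T + k * δ - δ) ω - 2 * B (T + k * δ) ω; P] =
      (1 / 2 ^ K) * (secondDiff
        (fun s => secondDiff (powSum (2 * H) 0 0 K s) (T + k * δ) δ) (T + j * δ) δ
        - δ ^ (2 * H * K) * fourthDiff (2 * H * K) (j - k)) := by
  have hL : ∀ t, MemLp (B t) 2 P := fun t => (hB.isGaussianProcess.hasGaussianLaw_eval t).memLp_two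
  have hL2 : ∀ t, MemLp (fun ω => 2 * B t ω) 2 P := fun t => (hL t).const_mul 2
  have hcov : ∀ s t, 0 < s → 0 < t → cov[B s, B t; P] =
      (1 / 2 ^ K) * (powSum (2 * H) 0 0 K s t - |s - t| ^ (2 * H * K)) := by
    intro s t hs ht
    rw [hB.cov_eq, covFun, powSum, abs_of_pos hs, abs_of_pos ht]
    simp
  -- On the grid |s - t|^p scales to δ^p |m|^p with m an integer shift of j - k; the nine
  -- covariances collect with weights 1, -4, 6, -4, 1.
  have habs : ∀ x y m : ℝ, x - y = m * δ →
      |x - y| ^ (2 * H * K) = δ ^ (2 * H * K) * |m| ^ (2 * H * K) := by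
    intro x y m h
    rw [h, abs_mul, abs_of_nonneg hδ, Real.mul_rpow (abs_nonneg _) hδ, mul_comm]
  have hA : ∀ s t, MemLp (fun ω => B s ω + B t ω) 2 P := fun s t => (hL s).add (hL t)
  have hexp : ∀ x₁ x₂ x₃ y₁ y₂ y₃ : ℝ,
      cov[fun ω => B x₁ ω + B x₂ ω - 2 * B x₃ ω, fun ω => B y₁ ω + B y₂ ω - 2 * B y₃ ω; P] =
      cov[B x₁, B y₁; P] + cov[B x₁, B y₂; P] - 2 * cov[B x₁, B y₃; P]
      + (cov[B x₂, B y₁; P] + cov[B x₂, B y₂; P] - 2 * cov[B x₂, B y₃; P])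
      - 2 * (cov[B x₃, B y₁; P] + cov[B x₃, B y₂; P] - 2 * cov[B x₃, B y₃; P]) := by
    intro x₁ x₂ x₃ y₁ y₂ y₃
    have h1 : ∀ x, cov[B x, fun ω => B y₁ ω + B y₂ ω - 2 * B y₃ ω; P] =
        cov[B x, B y₁; P] + cov[B x, B y₂; P] - 2 * cov[B x, B y₃; P] := by
      intro x
      rw [covariance_fun_sub_right (hL x) (hA y₁ y₂) (hL2 y₃),
        show cov[B x, fun ω => B y₁ ω + B y₂ ω; P] = _ from
          covariance_add_right (hL x) (hL y₁) (hL y₂), covariance_const_mul_right]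
    have hY : MemLp (fun ω => B y₁ ω + B y₂ ω - 2 * B y₃ ω) 2 P := (hA y₁ y₂).sub (hL2 y₃)
    rw [covariance_fun_sub_left (hA x₁ x₂) (hL2 x₃) hY,
      show cov[fun ω => B x₁ ω + B x₂ ω, fun ω => B y₁ ω + B y₂ ω - 2 * B y₃ ω; P] = _ from
        covariance_add_left (hL x₁) (hL x₂) hY, covariance_const_mul_left, h1, h1, h1]
  rw [hexp]
  have j1 : 0 < T + j * δ := by linarith
  have j2 : 0 < T + j * δ + δ := by linarith
  have k1 : 0 < T + k * δ := by linarith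
  have k2 : 0 < T + k * δ + δ := by linarith
  rw [hcov _ _ j2 k2, hcov _ _ j2 hk, hcov _ _ j2 k1, hcov _ _ hj k2, hcov _ _ hj hk,
    hcov _ _ hj k1, hcov _ _ j1 k2, hcov _ _ j1 hk, hcov _ _ j1 k1,
    habs _ _ (j - k) (by ring : T + j * δ + δ - (T + k * δ + δ) = _),
    habs _ _ (j - k + 2) (by ring : T + j * δ + δ - (T + k * δ - δ) = _),
    habs _ _ (j - k + 1) (by ring : T + j * δ + δ - (T + k * δ) = _),
    habs _ _ (j - k - 2) (by ring : T + j * δ - δ - (T + k * δ + δ) = _),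
    habs _ _ (j - k) (by ring : T + j * δ - δ - (T + k * δ - δ) = _),
    habs _ _ (j - k - 1) (by ring : T + j * δ - δ - (T + k * δ) = _),
    habs _ _ (j - k - 1) (by ring : T + j * δ - (T + k * δ + δ) = _),
    habs _ _ (j - k + 1) (by ring : T + j * δ - (T + k * δ - δ) = _),
    habs _ _ (j - k) (by ring : T + j * δ - (T + k * δ) = _)]
  simp only [secondDiff, fourthDiff]
  ring


/-! ### Nearly Toeplitz covariance matrices. -/

/-- Bordering the matrix by one row and column adds w(0) plus twice a partial sum of the symbol. A
sum of partial sums is what Cesàro's theorem needs. -/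
lemma sum_sum_range_toeplitz {w : ℤ → ℝ} (hw : ∀ m, w (-m) = w m) (N : ℕ) :
    ∑ j ∈ Finset.range N, ∑ k ∈ Finset.range N, w (j - k) =
      ∑ i ∈ Finset.range N, (w 0 + 2 * ∑ l ∈ Finset.range i, w (l + 1)) := by
  induction N with
  | zero => simp
  | succ N ih =>
    have h1 : ∑ k ∈ Finset.range N, w (N - k) = ∑ l ∈ Finset.range N, w (l + 1) := by
      rw [← Finset.sum_range_reflect]
      refine Finset.sum_congr rfl fun l hl => ?_
      have := Finset.mem_range.1 hl
      congr 1
      lia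
    have h2 : ∑ k ∈ Finset.range N, w (k - N) = ∑ l ∈ Finset.range N, w (l + 1) := by
      rw [← h1]
      exact Finset.sum_congr rfl fun k _ => by rw [← hw, neg_sub]
    simp only [Finset.sum_range_succ, Finset.sum_add_distrib]
    rw [h1, h2, sub_self, ih, Finset.sum_add_distrib]
    ring

lemma tendsto_toeplitz_average {w : ℤ → ℝ} (hw : ∀ m, w (-m) = w m)
    (hs : Summable fun l : ℕ => w (l + 1)) :
    Tendsto (fun n : ℕ => (∑ j : Fin (n - 1), ∑ k : Fin (n - 1), w ((j : ℕ) - (k : ℕ))) / n) atTop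
      (𝓝 (w 0 + 2 * ∑' l : ℕ, w (l + 1))) := by
  have h1 := ((hs.hasSum.tendsto_sum_nat.const_mul 2).const_add (w 0)).cesaro
  -- The matrix has size n - 1 but the divisor is n; after shifting n by one this costs the factor
  -- n/(n+1).
  have h2 : Tendsto (fun n : ℕ => (((n : ℝ) / ((n : ℝ) + 1)))) atTop (𝓝 1) :=
    tendsto_natCast_div_add_atTop 1
  rw [← tendsto_add_atTop_iff_nat 1]
  rw [← one_mul (w 0 + _)]
  refine (h2.mul h1).congr fun n => ?_
  rw [← sum_sum_range_toeplitz hw, add_tsub_cancel_right]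
  simp_rw [Finset.sum_range]
  push_cast
  rcases Nat.eq_zero_or_pos n with rfl | hn
  · simp
  · have : (0 : ℝ) < n := by exact_mod_cast hn
    field_simp

lemma sum_abs_toeplitz_row_le {w : ℤ → ℝ} (hs : Summable fun m => |w m|) {N : ℕ} (i : Fin N) :
    ∑ j : Fin N, |w ((i : ℕ) - (j : ℕ))| ≤ ∑' m, |w m| := by
  have hinj : Function.Injective fun j : Fin N => ((i : ℕ) : ℤ) - (j : ℕ) := by
    intro j k h
    ext
    simp only at h
    lia
  have := hs.sum_le_tsum (Finset.univ.map ⟨_, hinj⟩) fun _ _ => abs_nonneg _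
  simpa using this

/-- Central limit theorem for the squared norms of Gaussian vectors whose covariance matrices are,
up to a small error, normalized Toeplitz matrices with a summable symbol. -/
theorem tendstoInDistribution_sum_sq_of_toeplitz {Ω : Type*} [MeasurableSpace Ω] {P : Measure Ω}
    [IsProbabilityMeasure P] {X : ∀ n : ℕ, Fin (n - 1) → Ω → ℝ}
    (hX : ∀ n, HasGaussianLaw (fun ω => (X n · ω)) P) (hc : ∀ n i, ∫ ω, X n i ω ∂P = 0)
    {w : ℤ → ℝ} (hw : ∀ m, w (-m) = w m) (hs : Summable fun m => |w m|)
    (hs2 : Summable fun l : ℕ => w (l + 1) ^ 2)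
    {e : ∀ n : ℕ, Fin (n - 1) → Fin (n - 1) → ℝ} {ε : ℕ → ℝ} (he : ∀ n i j, |e n i j| ≤ ε n)
    (hε0 : ∀ n, 0 ≤ ε n) (hε : Tendsto (fun n => n * ε n) atTop (𝓝 0))
    (hcov : ∀ n i j, cov[X n i, X n j; P] = (w ((i : ℕ) - (j : ℕ)) + e n i j) / √n) :
    TendstoInDistribution (fun n ω => ∑ i, X n i ω ^ 2 - √n * w 0) atTop (id : ℝ → ℝ) (fun _ => P)
      (gaussianReal 0 (2 * (w 0 ^ 2 + 2 * ∑' l : ℕ, w (l + 1) ^ 2)).toNNReal) := by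
  set R := ∑' m, |w m| with hR
  have hR0 : 0 ≤ R := tsum_nonneg fun _ => abs_nonneg _
  have hinv : Tendsto (fun n : ℕ => (√(n : ℝ))⁻¹) atTop (𝓝 0) :=
    tendsto_inv_atTop_zero.comp (Real.tendsto_sqrt_atTop.comp tendsto_natCast_atTop_atTop)
  have hε' : Tendsto ε atTop (𝓝 0) := by
    have := hε.mul tendsto_inv_atTop_nhds_zero_nat
    rw [mul_zero] at this
    refine this.congr' ?_
    filter_upwards [eventually_gt_atTop 0] with n hn
    have : (0 : ℝ) < n := by exact_mod_cast hn
    field_simp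
  have hcard : ∀ n : ℕ, 0 < n → ((n - 1 : ℕ) : ℝ) ≤ n := fun n _ => by
    exact_mod_cast Nat.sub_le n 1
  refine tendstoInDistribution_sum_sq hX hc hcov (r := fun n => (R + n * ε n) * (√n)⁻¹) ?_ ?_ ?_ ?_
  · have hlim := tendsto_toeplitz_average (w := fun m => w m ^ 2) (fun m => by rw [hw]) hs2
    -- From |(w + e)² - w²| ≤ 2ε|w| + ε²: a row contributes at most (2Rε + nε²)/n, and there are
    -- fewer than n rows.
    have hdiff : Tendsto (fun n : ℕ => 2 * R * ε n + n * ε n * ε n) atTop (𝓝 0) := by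
      simpa using (hε'.const_mul (2 * R)).add (hε.mul hε')
    rw [← add_zero (w 0 ^ 2 + _)]
    have hzero : Tendsto (fun n : ℕ => (∑ i : Fin (n - 1), ∑ j : Fin (n - 1), ((w ((i : ℕ) - (j : ℕ)) + e n i j) / √n) ^ 2) -
        (∑ i : Fin (n - 1), ∑ j : Fin (n - 1), w ((i : ℕ) - (j : ℕ)) ^ 2) / n) atTop (𝓝 0) := by
      refine squeeze_zero_norm' ?_ hdiff
      filter_upwards [eventually_gt_atTop 0] with n hn
      have hn' : (0 : ℝ) < n := by exact_mod_cast hn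
      have hrow : ∀ i : Fin (n - 1), ∑ j : Fin (n - 1),
          |((w ((i : ℕ) - (j : ℕ)) + e n i j) / √n) ^ 2 - w ((i : ℕ) - (j : ℕ)) ^ 2 / n| ≤
          (2 * R * ε n + n * ε n * ε n) / n := by
        intro i
        have hterm : ∀ j : Fin (n - 1),
            |((w ((i : ℕ) - (j : ℕ)) + e n i j) / √n) ^ 2 - w ((i : ℕ) - (j : ℕ)) ^ 2 / n| ≤
            (2 * ε n * |w ((i : ℕ) - (j : ℕ))| + ε n * ε n) / n := by
          intro j
          rw [div_pow, Real.sq_sqrt hn'.le, ← sub_div, abs_div, abs_of_pos hn']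
          refine div_le_div_of_nonneg_right ?_ hn'.le
          rw [show (w ((i : ℕ) - (j : ℕ)) + e n i j) ^ 2 - w ((i : ℕ) - (j : ℕ)) ^ 2 =
            2 * e n i j * w ((i : ℕ) - (j : ℕ)) + e n i j * e n i j by ring]
          refine (abs_add_le _ _).trans ?_
          rw [abs_mul, abs_mul, abs_mul, abs_two]
          have := he n i j
          have := hε0 n
          gcongr
        refine (Finset.sum_le_sum fun j _ => hterm j).trans ?_
        rw [← Finset.sum_div, Finset.sum_add_distrib, ← Finset.mul_sum]
        refine div_le_div_of_nonneg_right ?_ hn'.le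
        have h1 := sum_abs_toeplitz_row_le hs i
        have h2 := hcard n hn
        have h3 := hε0 n
        simp only [Finset.sum_const, Finset.card_univ, Fintype.card_fin, nsmul_eq_mul]
        have h4 : 2 * ε n * ∑ j : Fin (n - 1), |w ((i : ℕ) - (j : ℕ))| ≤ 2 * ε n * R := by gcongr
        have h5 : ((n - 1 : ℕ) : ℝ) * (ε n * ε n) ≤ n * (ε n * ε n) := by gcongr
        linarith
      rw [Finset.sum_div, ← Finset.sum_sub_distrib]
      simp_rw [Finset.sum_div, ← Finset.sum_sub_distrib]
      refine (norm_sum_le_of_le _ fun i _ => (norm_sum_le _ _).trans (hrow i)).trans ?_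
      simp only [Finset.sum_const, Finset.card_univ, Fintype.card_fin, nsmul_eq_mul]
      have h3 := hε0 n
      rw [mul_div_assoc']
      exact (div_le_iff₀ hn').2 (by
        rw [mul_comm]
        exact mul_le_mul_of_nonneg_left (hcard n hn) (by positivity))
    exact (hlim.add hzero).congr fun n => by ring
  · filter_upwards [eventually_gt_atTop 0] with n hn i
    have hn' : (0 : ℝ) < n := by exact_mod_cast hn
    simp_rw [abs_div, abs_of_nonneg (Real.sqrt_nonneg (n : ℝ)), div_eq_mul_inv]
    rw [← Finset.sum_mul]
    refine mul_le_mul_of_nonneg_right ?_ (by positivity)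
    refine (Finset.sum_le_sum fun j _ => (abs_add_le _ _).trans
      (add_le_add le_rfl (he n i j))).trans ?_
    rw [Finset.sum_add_distrib]
    simp only [Finset.sum_const, Finset.card_univ, Fintype.card_fin, nsmul_eq_mul]
    exact add_le_add (sum_abs_toeplitz_row_le hs i)
      (mul_le_mul_of_nonneg_right (hcard n hn) (hε0 n))
  · simpa using (hε.const_add R).mul hinv
  · have hb : Tendsto (fun n : ℕ => (|w 0| + n * ε n) * (√(n : ℝ))⁻¹) atTop (𝓝 0) := by
      simpa using (hε.const_add |w 0|).mul hinv
    refine squeeze_zero_norm' ?_ hb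
    filter_upwards [eventually_gt_atTop 0] with n hn
    have hn' : (0 : ℝ) < n := by exact_mod_cast hn
    have hsq : √(n : ℝ) ≠ 0 := (Real.sqrt_pos.2 hn').ne'
    -- With n - 1 diagonal entries the trace misses √n w(0) by -w(0)/√n, besides the error terms.
    have e1 : ∑ i : Fin (n - 1), (w ((i : ℕ) - (i : ℕ)) + e n i i) / √n - √n * w 0 =
        (-w 0 + ∑ i, e n i i) * (√n)⁻¹ := by
      simp only [sub_self]
      rw [← Finset.sum_div, Finset.sum_add_distrib]
      simp only [Finset.sum_const, Finset.card_univ, Fintype.card_fin, nsmul_eq_mul]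
      rw [Nat.cast_pred hn]
      field_simp
      rw [Real.sq_sqrt hn'.le]
      ring
    rw [e1, norm_mul, Real.norm_eq_abs, norm_inv, Real.norm_of_nonneg (Real.sqrt_nonneg _)]
    refine mul_le_mul_of_nonneg_right ((abs_add_le _ _).trans ?_) (by positivity)
    rw [abs_neg]
    refine add_le_add le_rfl ((Finset.abs_sum_le_sum_abs _ _).trans
      ((Finset.sum_le_sum fun i _ => he n i i).trans ?_))
    simp only [Finset.sum_const, Finset.card_univ, Fintype.card_fin, nsmul_eq_mul]
    exact mul_le_mul_of_nonneg_right (hcard n hn) (hε0 n)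


/-! ### Application to two-parameter fractional Brownian motion. -/

lemma hasGaussianLaw_secondDiff {Ω ι : Type*} [MeasurableSpace Ω] [Fintype ι] {P : Measure Ω}
    {B : ℝ → Ω → ℝ} (hB : IsGaussianProcess B P) (c : ℝ) (x₁ x₂ x₃ : ι → ℝ) :
    HasGaussianLaw (fun ω i => c * (B (x₁ i) ω + B (x₂ i) ω - 2 * B (x₃ i) ω)) P := by
  classical
  set I : Finset ℝ := Finset.univ.image x₁ ∪ Finset.univ.image x₂ ∪ Finset.univ.image x₃ with hI
  have m₁ : ∀ i, x₁ i ∈ I := fun i => by simp [hI]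
  have m₂ : ∀ i, x₂ i ∈ I := fun i => by simp [hI]
  have m₃ : ∀ i, x₃ i ∈ I := fun i => by simp [hI]
  let L : (I → ℝ) →L[ℝ] (ι → ℝ) := ContinuousLinearMap.pi fun i =>
    c • (ContinuousLinearMap.proj ⟨x₁ i, m₁ i⟩ + ContinuousLinearMap.proj ⟨x₂ i, m₂ i⟩ -
      (2 : ℝ) • ContinuousLinearMap.proj ⟨x₃ i, m₃ i⟩)
  have hL : (fun ω i => c * (B (x₁ i) ω + B (x₂ i) ω - 2 * B (x₃ i) ω)) =
      fun ω => L (I.restrict (B · ω)) := by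
    ext ω i
    simp [L]
  exact hL ▸ (hB.hasGaussianLaw I).map_fun L

end TwoParamFBM

open TwoParamFBM in
theorem proposition5 {Ω : Type*} [MeasurableSpace Ω] (P : Measure Ω) [IsProbabilityMeasure P]
    (H K : ℝ) (hH : 0 < H) (hH1 : H < 1) (hK : 0 < K) (hK1 : K < 1)
    (T₁ T₂ : ℝ) (hT₁ : 0 < T₁) (hT : T₁ < T₂)
    (B : ℝ → Ω → ℝ) (hB : TwoParamFBM.IsTwoParamFBM H K B P) :
    -- the series in the limiting variance converges
    Summable (fun l : ℕ => TwoParamFBM.rho (2 - 2 * (H * K)) (l + 2) ^ 2) ∧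
    -- convergence in law to the centered Gaussian law; the variance is a nonnegative real
    TendstoInDistribution
      (fun (n : ℕ) (ω : Ω) =>
        √(n : ℝ) * ((n : ℝ) ^ (2 * H * K - 1)
            * TwoParamFBM.quadVar (TwoParamFBM.rescale B T₁ T₂) n ω
          - (4 - 2 ^ (2 * H * K)) / 2 ^ (K - 1) * (T₂ - T₁) ^ (2 * H * K)))
      atTop (id : ℝ → ℝ) (fun _ => P)
      (gaussianReal 0 (Real.toNNReal
        ((T₂ - T₁) ^ (4 * H * K) / 2 ^ (2 * (K - 1)) * TwoParamFBM.sigmaSqFBM (H * K)))) := by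
  set p : ℝ := 2 * H * K with hp
  have hp0 : 0 < p := by positivity
  have hp2 : p < 2 := by nlinarith
  have hγ : 2 - 2 * (H * K) = 2 - p := by rw [hp]; ring
  refine ⟨summable_rho_sq (by rw [hγ]; linarith), ?_⟩
  set a := T₂ - T₁ with ha
  have ha0 : 0 < a := sub_pos.2 hT
  have h2K : (0 : ℝ) < 2 ^ K := Real.rpow_pos_of_pos two_pos K
  set c : ℝ := a ^ p / 2 ^ K with hc
  set w : ℤ → ℝ := fun m => -c * fourthDiff p m with hw
  have hw0 : w 0 = (4 - 2 ^ p) / 2 ^ (K - 1) * a ^ p := by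
    simp only [hw, Int.cast_zero, fourthDiff_zero hp0, hc]
    rw [Real.rpow_sub two_pos, Real.rpow_one]
    field_simp
  obtain ⟨hs2, ht2⟩ := tsum_fourthDiff_sq hp0 hp2
  -- Since w(0) = 2c(4 - 2^p), the left side is 4c² times the bracket defining σ², and 4c² is the
  -- stated prefactor.
  have hvar : 2 * (w 0 ^ 2 + 2 * ∑' l : ℕ, w (l + 1) ^ 2) =
      a ^ (4 * H * K) / 2 ^ (2 * (K - 1)) * sigmaSqFBM (H * K) := by
    have e1 : ∑' l : ℕ, w (l + 1) ^ 2 = c ^ 2 * ∑' l : ℕ, fourthDiff p ((l : ℝ) + 1) ^ 2 := by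
      rw [← tsum_mul_left]
      refine tsum_congr fun l => ?_
      simp only [hw]
      push_cast
      ring
    have e2 : a ^ (4 * H * K) = (a ^ p) ^ 2 := by
      rw [← Real.rpow_natCast, ← Real.rpow_mul ha0.le, hp]
      congr 1
      push_cast
      ring
    have e3 : (2 : ℝ) ^ (2 * (K - 1)) = (2 ^ (K - 1)) ^ 2 := by
      rw [← Real.rpow_natCast, ← Real.rpow_mul two_pos.le]
      congr 1
      push_cast
      ring
    rw [e1, ht2, e2, e3, hw0, hc, sigmaSqFBM, hγ, show 2 * (H * K) = p by rw [hp]; ring,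
      Real.rpow_sub two_pos, Real.rpow_one]
    field_simp
    ring
  -- T₁ > 0 keeps the whole grid away from the origin, where the derivatives of `powSum` may blow
  -- up.
  obtain ⟨C, hC⟩ := exists_abs_secondDiff_secondDiff_powSum_le (2 * H) 0 0 K hT₁ T₂
  set E : ∀ n : ℕ, Fin (n - 1) → Fin (n - 1) → ℝ := fun n i j => secondDiff
    (fun s => secondDiff (powSum (2 * H) 0 0 K s) (T₁ + ((j : ℕ) + 1) * (a / n)) (a / n))
    (T₁ + ((i : ℕ) + 1) * (a / n)) (a / n) with hE
  have hgrid : ∀ (n : ℕ) (i : Fin (n - 1)), (0 : ℝ) < n ∧ 0 ≤ a / n ∧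
      T₁ ≤ T₁ + ((i : ℕ) + 1) * (a / n) - a / n ∧ T₁ + ((i : ℕ) + 1) * (a / n) + a / n ≤ T₂ := by
    intro n i
    have hi := i.2
    have hn : (0 : ℝ) < n := by exact_mod_cast (by lia : 0 < n)
    have hin : ((i : ℕ) : ℝ) + 2 ≤ n := by exact_mod_cast (by lia : (i : ℕ) + 2 ≤ n)
    have hδ : 0 ≤ a / n := by positivity
    refine ⟨hn, hδ, ?_, ?_⟩
    · have : 0 ≤ ((i : ℕ) : ℝ) * (a / n) := by positivity
      linarith
    · have h1 : (((i : ℕ) : ℝ) + 2) * (a / n) ≤ n * (a / n) := by gcongr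
      rw [mul_div_cancel₀ _ hn.ne'] at h1
      linarith
  have hCE : ∀ n i j, |E n i j| ≤ C * (a / n) ^ 4 := fun n i j =>
    hC _ _ _ (hgrid n i).2.1 (hgrid n i).2.2.1 (hgrid n i).2.2.2 (hgrid n j).2.2.1 (hgrid n j).2.2.2
  -- The index i stands for k = i + 1. Squaring the factor gives n^(p-1/2) = √n n^(p-1).
  set X : ∀ n : ℕ, Fin (n - 1) → Ω → ℝ := fun n i ω => (n : ℝ) ^ (p / 2 - 1 / 4) *
    (B (T₁ + ((i : ℕ) + 1) * (a / n) + a / n) ω + B (T₁ + ((i : ℕ) + 1) * (a / n) - a / n) ω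
      - 2 * B (T₁ + ((i : ℕ) + 1) * (a / n)) ω) with hX
  have hint : ∀ t, Integrable (B t) P := fun t =>
    (hB.isGaussianProcess.hasGaussianLaw_eval t).integrable
  have hcov : ∀ n i j, cov[X n i, X n j; P] =
      (w ((i : ℕ) - (j : ℕ)) + (n : ℝ) ^ p * E n i j / 2 ^ K) / √n := by
    intro n i j
    obtain ⟨hn, hδ, hi, -⟩ := hgrid n i
    have hj := (hgrid n j).2.2.1
    simp only [hX]
    rw [covariance_const_mul_left, covariance_const_mul_right,
      cov_increment hB hδ (hT₁.trans_le hi) (hT₁.trans_le hj), ← mul_assoc, ← Real.rpow_add hn,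
      show p / 2 - 1 / 4 + (p / 2 - 1 / 4) = p - 1 / 2 by ring, Real.rpow_sub hn, ← Real.sqrt_eq_rpow,
      Real.div_rpow ha0.le hn.le]
    have hnp : (n : ℝ) ^ p ≠ 0 := (Real.rpow_pos_of_pos hn p).ne'
    have hsq : √(n : ℝ) ≠ 0 := (Real.sqrt_pos.2 hn).ne'
    simp only [hw, hE, hc]
    rw [show ((i : ℕ) : ℝ) + 1 - ((j : ℕ) + 1) = (((i : ℕ) - (j : ℕ) : ℤ) : ℝ) by push_cast; ring]
    field_simp
    ring
  have hmain := tendstoInDistribution_sum_sq_of_toeplitz (P := P) (X := X)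
    (fun n => hasGaussianLaw_secondDiff hB.isGaussianProcess _ _ _ _)
    (fun n i => by
      simp only [hX]
      have hadd : ∀ s t, Integrable (fun ω => B s ω + B t ω) P := fun s t => (hint s).add (hint t)
      rw [integral_const_mul, integral_sub (hadd _ _) ((hint _).const_mul 2),
        integral_add (hint _) (hint _), integral_const_mul, hB.centered, hB.centered, hB.centered]
      simp)
    (w := w) (fun m => by simp only [hw, Int.cast_neg, fourthDiff_neg])
    (by simpa only [hw, abs_mul] using (summable_abs_fourthDiff hp0 hp2).mul_left |-c|)
    (by
      refine (hs2.mul_left (c ^ 2)).congr fun l => ?_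
      simp only [hw]
      push_cast
      ring)
    (e := fun n i j => (n : ℝ) ^ p * E n i j / 2 ^ K)
    -- The error is of order n^(p-4), so n ε is of order n^(p-3) and tends to 0 because p < 2.
    (ε := fun n => (n : ℝ) ^ p * (|C| * (a / n) ^ 4) / 2 ^ K)
    (fun n i j => by
      rw [abs_div, abs_mul, abs_of_pos h2K, abs_of_nonneg (Real.rpow_nonneg n.cast_nonneg p)]
      have : |E n i j| ≤ |C| * (a / n) ^ 4 := (hCE n i j).trans
        (mul_le_mul_of_nonneg_right (le_abs_self C) (by positivity))
      gcongr)
    (fun n => by positivity)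
    (by
      have h := (tendsto_rpow_neg_atTop (y := 3 - p) (by linarith)).comp
        (tendsto_natCast_atTop_atTop (R := ℝ))
      have h' := h.const_mul (|C| * a ^ 4 / 2 ^ K)
      rw [mul_zero] at h'
      refine h'.congr' ?_
      filter_upwards [eventually_gt_atTop 0] with n hn
      have hn' : (0 : ℝ) < n := by exact_mod_cast hn
      simp only [Function.comp]
      rw [neg_sub, Real.rpow_sub hn', show (3 : ℝ) = (3 : ℕ) by norm_num, Real.rpow_natCast]
      field_simp)
    hcov
  rw [hvar] at hmain
  convert hmain using 3 with n ω
  -- At n = 0 both sides are 0: √0 = 0 and the sum is empty.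
  rcases Nat.eq_zero_or_pos n with rfl | hn
  · simp
  have hn' : (0 : ℝ) < n := by exact_mod_cast hn
  have hV : ∑ i, X n i ω ^ 2 = (n : ℝ) ^ (p - 1 / 2) * quadVar (rescale B T₁ T₂) n ω := by
    have hIcc : Finset.Icc 1 (n - 1) = Finset.Ico 1 n := by
      ext k
      simp only [Finset.mem_Icc, Finset.mem_Ico]
      lia
    rw [quadVar, hIcc, Finset.sum_Ico_eq_sum_range, Finset.sum_range, Finset.mul_sum]
    refine Finset.sum_congr rfl fun i _ => ?_
    simp only [hX, rescale, mul_pow]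
    rw [← Real.rpow_natCast, ← Real.rpow_mul hn'.le,
      show (p / 2 - 1 / 4) * ((2 : ℕ) : ℝ) = p - 1 / 2 by push_cast; ring]
    push_cast
    have e₁ : T₁ + (((i : ℕ) : ℝ) + 1) * (a / n) + a / n = (T₂ - T₁) * ((1 + (i : ℕ) + 1) / n) + T₁ := by
      rw [← ha]; field_simp; ring
    have e₂ : T₁ + (((i : ℕ) : ℝ) + 1) * (a / n) - a / n = (T₂ - T₁) * ((1 + (i : ℕ) - 1) / n) + T₁ := by
      rw [← ha]; field_simp; ring
    have e₃ : T₁ + (((i : ℕ) : ℝ) + 1) * (a / n) = (T₂ - T₁) * ((1 + (i : ℕ)) / n) + T₁ := by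
      rw [← ha]; field_simp; ring
    rw [e₁, e₂, e₃]
  rw [hV, hw0, mul_sub, ← mul_assoc, Real.sqrt_eq_rpow, ← Real.rpow_add hn',
    show 1 / 2 + (p - 1) = p - 1 / 2 by ring]
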